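/- Let $\mathbf M_1=\langle M;G_1\rangle$ be a finite algebra, let $\mathcal A=\mathsf{ISP}(\mathbf M_1)$ be the class of isomorphic copies of non-empty subalgebras of powers of $\mathbf M_1$, and let $\mathcal A_{\mathscr T}=\mathsf{IS}_{\mathrm c}\mathsf P(\mathbf M_1^{\mathscr T})$ be the class of isomorphic copies (algebraic and topological) of non-empty topologically closed subalgebras of powers of $\mathbf M_1$ with the discrete topology. Assume that $\mathcal A_{\mathscr T}$ is standard, i.e. it consists precisely of the Boolean-topological algebras (compact Hausdorff zero-dimensional, with continuous operations) that satisfy the quasi-equations true in $\mathbf M_1$. For $\mathbf A\in\mathcal A$ let $\mathcal A(\mathbf A,\mathbf M_1)$ be the set of homomorphisms $\mathbf A\to\mathbf M_1$, let $e_{\mathbf A}\colon \mathbf A\to \mathbf M_1^{\mathcal A(\mathbf A,\mathbf M_1)}$, $e_{\mathbf A}(a)(x)=x(a)$, be evaluation, and let the natural extension $n_{\mathcal A}(\mathbf A)$ be the topologically closed subalgebra of $(\mathbf M_1^{\mathscr T})^{\mathcal A(\mathbf A,\mathbf M_1)}$ generated by $e_{\mathbf A}(A)$. The zero-dimensional Bohr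 compactification $b_0(\mathbf A)$ is the Boolean-topological algebra with algebraic reduct in $\mathcal A$, together with an embedding $\iota_{\mathbf A}\colon\mathbf A\to b_0(\mathbf A)$ with dense image, such that for every Boolean-topological algebra $\mathbf B$ with algebraic reduct in $\mathcal A$ and every homomorphism $g\colon\mathbf A\to\mathbf B$ there is a unique continuous homomorphism $h\colon b_0(\mathbf A)\to\mathbf B$ with $h\circ\iota_{\mathbf A}=g$. Then: (i) $b_0(\mathbf A)=n_{\mathcal A}(\mathbf A)$, with embedding $e_{\mathbf A}$, for every $\mathbf A\in\mathcal A$. (ii) Suppose moreover that $\mathbf M_1$ is dualisable (as is, for example, every finite lattice), and let $\mathbf M_2=\langle M;G_2,H_2,R_2\rangle$ be a structure, with total operations, partial operations and relations, that is compatible with $\mathbf M_1$ (all operations, and all partial operations on their domains, are homomorphisms, and all relations and all domains of partial operations are subalgebras of powers of $\mathbf M_1$, possibly empty) and whose alter ego $\mathbf M_2^{\mathscr T}$ (that is, $\mathbf M_2$ with the discrete topology) dualises $\mathbf M_1$: for each $\mathbf A\in\mathcal A$, evaluation is an isomorphism from $\mathbf A$ onto the algebra of all continuous structure-preserving maps $\mathrm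 D(\mathbf A)\to\mathbf M_2^{\mathscr T}$, where $\mathrm D(\mathbf A)=\mathcal A(\mathbf A,\mathbf M_1)$ is regarded as a closed substructure of $(\mathbf M_2^{\mathscr T})^{A}$. Then for every $\mathbf A\in\mathcal A$ the set of all (not necessarily continuous) maps $\mathcal A(\mathbf A,\mathbf M_1)\to M$ that preserve the structure $\mathbf M_2$ equals $n_{\mathcal A}(\mathbf A)$, and, with the algebraic structure and topology inherited from $(\mathbf M_1^{\mathscr T})^{\mathcal A(\mathbf A,\mathbf M_1)}$ and with the embedding $e_{\mathbf A}$, it is $b_0(\mathbf A)$. -/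

import Mathlib

open FirstOrder FirstOrder.Language.Structure

universe u v w z

namespace NatExt

/-! ### Algebras, products, topological algebras -/

section Algebra

variable (L : FirstOrder.Language.{v, w})

/-- Powers carry the coordinatewise structure. -/
instance piStructure (I : Type*) (M : Type*) [L.Structure M] : L.Structure (I → M) where
  funMap f x := fun i => funMap f (fun j => x j i)
  RelMap r x := ∀ i, RelMap r (fun j => x j i)

/-- `A ∈ ISP(M)`: `A` is non-empty and isomorphic to a substructure of a power of `M`
(the empty power is allowed). -/
def InISP (M A : Type u) [L.Structure M] [L.Structure A] : Prop :=
  Nonempty A ∧ ∃ I : Type u, Nonempty (A ↪[L] (I → M))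

/-- The topology of `B` is compatible with its structure: operations are continuous,
relations are closed. -/
structure IsTopological (B : Type*) [L.Structure B] [TopologicalSpace B] : Prop where
  continuous_funMap : ∀ {n : ℕ} (f : L.Functions n), Continuous (fun x : Fin n → B => funMap f x)
  isClosed_relMap : ∀ {n : ℕ} (r : L.Relations n), IsClosed {x : Fin n → B | RelMap r x}

/-- Boolean-topological structures: topological structures on a compact Hausdorff
zero-dimensional (equivalently, totally disconnected) space. -/
structure IsBooleanTopological (B : Type*) [L.Structure B] [TopologicalSpace B] : Prop where
  compact : CompactSpace B
  t2 : T2Space B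
  totallyDisconnected : TotallyDisconnectedSpace B
  topological : IsTopological L B

/-- `B ∈ A^Bt`, where `A = ISP(M)`: Boolean-topological structures with reduct in `ISP(M)`. -/
def InBt (M B : Type u) [L.Structure M] [L.Structure B] [TopologicalSpace B] : Prop :=
  IsBooleanTopological L B ∧ InISP L M B

/-- `B ∈ IS_cP(M)`, for `M` with its topology: `B` is isomorphic, as a structure with topology,
to a non-empty topologically closed substructure of a power of `M`. -/
def InIScP (M B : Type u) [L.Structure M] [TopologicalSpace M]
    [L.Structure B] [TopologicalSpace B] : Prop :=
  ∃ (I : Type u) (T : L.Substructure (I → M)),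
    (T : Set (I → M)).Nonempty ∧ IsClosed (T : Set (I → M)) ∧
      ∃ e : B ≃[L] T, Continuous e ∧ Continuous e.symm

/-- A quasi-equation `s₁ ≈ t₁ ∧ ⋯ ∧ sₖ ≈ tₖ → s ≈ t` (with `k = 0` allowed) in an
algebraic language. -/
structure QuasiEquation where
  hyps : List (L.Term ℕ × L.Term ℕ)
  lhs : L.Term ℕ
  rhs : L.Term ℕ

variable {L} in
/-- The algebra `B` satisfies the quasi-equation `q`. -/
def QuasiEquation.Holds (q : QuasiEquation L) (B : Type*) [L.Structure B] : Prop :=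
  ∀ ρ : ℕ → B, (∀ p ∈ q.hyps, p.1.realize ρ = p.2.realize ρ) → q.lhs.realize ρ = q.rhs.realize ρ

/-- `IS_cP(M)` is standard: it consists precisely of the (non-empty) Boolean-topological
algebras that satisfy the quasi-equations true in `M`. -/
def IsStandard [L.IsAlgebraic] (M : Type u) [L.Structure M] [TopologicalSpace M] : Prop :=
  ∀ (B : Type u) [L.Structure B] [TopologicalSpace B],
    InIScP L M B ↔ Nonempty B ∧ IsBooleanTopological L B ∧
      ∀ q : QuasiEquation L, q.Holds M → q.Holds B

/-- `ι : A → B` exhibits `B` as the zero-dimensional Bohr compactification of `A` in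
`ISP(M)`: `B` is a Boolean-topological structure with reduct in `ISP(M)`, `ι` is an embedding of
structures with dense range, and every homomorphism from `A` to a Boolean-topological structure
with reduct in `ISP(M)` factors uniquely through `ι` by a continuous homomorphism. -/
structure IsZeroDimBohr (M A B : Type u) [L.Structure M] [L.Structure A] [L.Structure B]
    [TopologicalSpace B] (ι : A →[L] B) : Prop where
  mem : InBt L M B
  embedding : ∃ j : A ↪[L] B, j.toHom = ι
  dense : DenseRange ι
  universal : ∀ (C : Type u) [L.Structure C] [TopologicalSpace C], InBt L M C →
    ∀ g : A →[L] C, ∃! h : B →[L] C, Continuous h ∧ h.comp ι = g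

/-! ### The natural extension -/

variable (M A : Type u) [L.Structure M] [L.Structure A]

/-- The evaluation map `e_A : A → M ^ A(A, M)`, `e_A(a)(x) = x(a)`. -/
def evalHom : A →[L] ((A →[L] M) → M) where
  toFun a := fun x => x a
  map_fun' f a := by
    funext x
    exact x.map_fun f a
  map_rel' r a h := fun x => x.map_rel r a h

/-- The natural extension of `A` in `ISP(M)`: the topologically closed substructure of
`M ^ A(A, M)` generated by the image of the evaluation map. -/
def natExt [TopologicalSpace M] : L.Substructure ((A →[L] M) → M) :=
  sInf {T | IsClosed (T : Set ((A →[L] M) → M)) ∧ Set.range (evalHom L M A) ⊆ T}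

/-- The evaluation map with codomain the natural extension. -/
def natExtEval [TopologicalSpace M] : A →[L] natExt L M A :=
  (evalHom L M A).codRestrict (natExt L M A) fun a => by
    rw [natExt, FirstOrder.Language.Substructure.mem_sInf]
    exact fun T hT => hT.2 ⟨a, rfl⟩

/-- The hom-set `A(A, M)` is topologised as a subspace of the power `M ^ A`. -/
instance homTopology [TopologicalSpace M] : TopologicalSpace (A →[L] M) :=
  TopologicalSpace.induced (fun x : A →[L] M => (x : A → M)) inferInstance

end Algebra

/-! ### Structures with partial operations, alter egos, duality -/

/-- A signature of finitary total operations, partial operations and relations. -/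
structure Signature where
  Op : ℕ → Type z
  POp : ℕ → Type z
  Rel : ℕ → Type z

/-- A structure `⟨X; G, H, R⟩` with total operations, partial operations and relations. -/
class Str (S : Signature.{z}) (X : Type u) where
  op : ∀ {n : ℕ}, S.Op n → (Fin n → X) → X
  pop : ∀ {n : ℕ}, S.POp n → (Fin n → X) →. X
  rel : ∀ {n : ℕ}, S.Rel n → (Fin n → X) → Prop

/-- `α : X → Y` is a homomorphism ("preserves the structure"). For a partial operation `h`: if
`h x` is defined, so is `h (α ∘ x)`, and `α (h x) = h (α ∘ x)`. -/
structure IsHom (S : Signature.{z}) {X Y : Type u} [Str S X] [Str S Y] (α : X → Y) : Prop where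
  map_op : ∀ {n : ℕ} (g : S.Op n) (x : Fin n → X), α (Str.op g x) = Str.op g (α ∘ x)
  map_pop : ∀ {n : ℕ} (h : S.POp n) (x : Fin n → X), ∀ y ∈ Str.pop h x, α y ∈ Str.pop h (α ∘ x)
  map_rel : ∀ {n : ℕ} (r : S.Rel n) (x : Fin n → X), Str.rel r x → Str.rel r (α ∘ x)

/-- The structure `M₂` of signature `S` on `M` is compatible with the algebra `M₁` of language `L`
on `M`: total operations of `M₂` are homomorphisms `M₁ⁿ → M₁`; the domain of each partial operation
is a (possibly empty) substructure of `M₁ⁿ` on which the partial operation is a homomorphism to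
`M₁`; and each relation is a substructure of `M₁ⁿ`. -/
structure Compatible (L : FirstOrder.Language.{v, w}) (S : Signature.{z}) (M : Type u)
    [L.Structure M] [Str S M] : Prop where
  op : ∀ {n k : ℕ} (g : S.Op n) (f : L.Functions k) (xs : Fin k → Fin n → M),
    Str.op g (fun i => funMap f (fun j => xs j i)) = funMap f (fun j => Str.op g (xs j))
  pop : ∀ {n k : ℕ} (h : S.POp n) (f : L.Functions k) (xs : Fin k → Fin n → M) (ys : Fin k → M),
    (∀ j, ys j ∈ Str.pop h (xs j)) →
      funMap f ys ∈ Str.pop h (fun i => funMap f (fun j => xs j i))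
  rel : ∀ {n k : ℕ} (r : S.Rel n) (f : L.Functions k) (xs : Fin k → Fin n → M),
    (∀ j, Str.rel r (xs j)) → Str.rel r (fun i => funMap f (fun j => xs j i))

section Duality

variable {L : FirstOrder.Language.{v, w}} [L.IsAlgebraic] {S : Signature.{z}} {M : Type u}
  [L.Structure M] [Str S M]

/-- The dual `D(A)`: the hom-set `A(A, M₁)` with the structure of a substructure of the
power `M₂ ^ A`, i.e. with operations, partial operations and relations defined pointwise. -/
@[reducible]
def dual (hc : Compatible L S M) (A : Type u) [L.Structure A] : Str S (A →[L] M) where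
  op g x :=
    { toFun := fun a => Str.op g (fun i => x i a)
      map_fun' := fun f a => by
        have := hc.op g f (fun j i => x i (a j))
        rw [Function.comp_def, ← this]
        congr 1
        funext i
        exact (x i).map_fun f a
      map_rel' := fun r => isEmptyElim r }
  pop h x :=
    { Dom := ∀ a, (Str.pop h (fun i => x i a)).Dom
      get := fun hd =>
        { toFun := fun a => (Str.pop h (fun i => x i a)).get (hd a)
          map_fun' := fun f a => by
            have key := hc.pop h f (fun j i => x i (a j))
              (fun j => (Str.pop h (fun i => x i (a j))).get (hd (a j)))
              (fun j => Part.get_mem _)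
            have e : (fun i => x i (funMap f a)) = fun i => funMap f (fun j => x i (a j)) := by
              funext i
              exact (x i).map_fun f a
            have key' : funMap f (fun j => (Str.pop h (fun i => x i (a j))).get (hd (a j))) ∈
                Str.pop h (fun i => x i (funMap f a)) := by
              rw [e]
              exact key
            exact Part.mem_unique (Part.get_mem _) key'
          map_rel' := fun r => isEmptyElim r } }
  rel r x := ∀ a, Str.rel r (fun i => x i a)

/-- `G(X)`: the set of all homomorphisms `X → M₂`, as a substructure of the power `M₁ ^ X`. -/
def homs (hc : Compatible L S M) (X : Type u) [Str S X] : L.Substructure (X → M) where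
  carrier := {α | IsHom S α}
  fun_mem f α hα :=
    { map_op := fun g x => by
        have := hc.op g f (fun j i => α j (x i))
        refine Eq.trans ?_ this.symm
        exact congrArg (funMap f) (funext fun j => (hα j).map_op g x)
      map_pop := fun h x y hy => hc.pop h f (fun j i => α j (x i)) (fun j => α j y)
        (fun j => (hα j).map_pop h x y hy)
      map_rel := fun r x hx => hc.rel r f (fun j i => α j (x i)) (fun j => (hα j).map_rel r x hx) }

/-- `E(X)`: the set of all continuous homomorphisms from `X` to the alter ego of `M₁`, as a
substructure of the power `M₁ ^ X`. -/
def contHoms [Finite M] [TopologicalSpace M] [DiscreteTopology M]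
    (hc : Compatible L S M) (X : Type u) [Str S X] [TopologicalSpace X] :
    L.Substructure (X → M) where
  carrier := {α | IsHom S α ∧ Continuous α}
  fun_mem f α hα :=
    ⟨(homs hc X).fun_mem f α (fun j => (hα j).1),
      (continuous_of_discreteTopology (f := fun y : Fin _ → M => funMap f y)).comp
        (continuous_pi fun j => (hα j).2)⟩

/-- The alter ego (`M₂` with the discrete topology) dualises `M₁`: for every `A ∈ ISP(M₁)` the
evaluation map is an isomorphism from `A` onto `E(D(A))`. -/
def Dualises [Finite M] [TopologicalSpace M] [DiscreteTopology M]
    (hc : Compatible L S M) : Prop :=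
  ∀ (A : Type u) [L.Structure A], InISP L M A →
    letI := dual hc A
    ∃ φ : A ≃[L] contHoms hc (A →[L] M), ∀ (a : A) (x : A →[L] M), (φ a).1 x = x a

/-- `G(D(A)♭)`: all maps `A(A, M₁) → M` that preserve the structure `M₂`. -/
def doubleDual (hc : Compatible L S M) (A : Type u) [L.Structure A] :
    L.Substructure ((A →[L] M) → M) :=
  letI := dual hc A
  homs hc (A →[L] M)

/-- The evaluation map with codomain `G(D(A)♭)`. -/
def doubleDualEval (hc : Compatible L S M) (A : Type u) [L.Structure A] :
    A →[L] doubleDual hc A :=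
  (evalHom L M A).codRestrict (doubleDual hc A) fun a =>
    letI := dual hc A
    show IsHom S (fun x : A →[L] M => x a) from
    { map_op := fun _ _ => rfl
      map_pop := fun h x y hy => by
        obtain ⟨hd, rfl⟩ := hy
        exact Part.get_mem (hd a)
      map_rel := fun _ _ hx => hx a }

end Duality

end NatExt

/-! Since the operations are continuous, the natural extension is just the topological closure of
`e_A(A)`, and both parts concern this closure. (i) Standardness places every Boolean-topological `C`
with reduct in `ISP(M)` as a closed subalgebra of some `M ^ I`. A homomorphism `A → C` is then an
`I`-indexed family of elements of `A(A, M)`, and reindexing along it is a continuous homomorphism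
between powers of `M` that extends it (`IsStandard.exists_extension`). Density gives uniqueness.
(ii) Structure-preserving maps form a closed set containing the evaluations. Conversely, to
approximate such a map on a finite `F ⊆ A(A, M)`, pass to the image `B` of `A` in `M ^ F`. Its dual
is finite, so continuity there is automatic and duality yields an evaluation
(`Dualises.exists_eq_on_finset`). -/

namespace NatExt

/-! ### Closures in powers and the universal property. -/

section Algebra

variable {L : FirstOrder.Language.{v, w}}

/-- The coordinate projections of a power are homomorphisms. -/
def piProj {I : Type*} {M : Type*} [L.Structure M] (i : I) : (I → M) →[L] M where
  toFun x := x i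
  map_fun' _ _ := rfl
  map_rel' _ _ h := h i

/-- Reindexing `M ^ J → M ^ I` along a map `I → J` is a homomorphism. -/
def piReindex {I J : Type*} (M : Type*) [L.Structure M] (σ : I → J) : (J → M) →[L] (I → M) where
  toFun x := x ∘ σ
  map_fun' _ _ := rfl
  map_rel' _ _ h := fun i => h (σ i)

theorem continuous_piReindex {I J M : Type*} [L.Structure M] [TopologicalSpace M] (σ : I → J) :
    Continuous (piReindex (L := L) M σ) :=
  continuous_pi fun i => continuous_apply (σ i)

theorem QuasiEquation.Holds.of_inISP {M A : Type u} [L.Structure M] [L.Structure A]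
    (hA : InISP L M A) {q : QuasiEquation L} (hq : q.Holds M) : q.Holds A := by
  obtain ⟨-, I, ⟨j⟩⟩ := hA
  intro ρ hρ
  apply j.injective
  funext i
  have key : ∀ t : L.Term ℕ, j (t.realize ρ) i = t.realize fun n => j (ρ n) i := fun t =>
    (FirstOrder.Language.HomClass.realize_term ((piProj (L := L) i).comp j.toHom)
      (t := t) (v := ρ)).symm
  rw [key, key]
  exact hq _ fun p hp => by rw [← key, ← key, hρ p hp]

theorem InISP.evalHom_injective {M A : Type u} [L.Structure M] [L.Structure A]
    (hA : InISP L M A) : Function.Injective (evalHom L M A) := by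
  obtain ⟨-, I, ⟨j⟩⟩ := hA
  intro a b hab
  apply j.injective
  funext i
  exact congrFun hab ((piProj i).comp j.toHom)

variable {M : Type u} [L.Structure M] [TopologicalSpace M]

theorem continuous_funMap_pi [Finite M] [DiscreteTopology M] {I : Type*} {n : ℕ}
    (f : L.Functions n) : Continuous fun x : Fin n → I → M => funMap f x :=
  continuous_pi fun i =>
    (continuous_of_discreteTopology (f := fun y : Fin n → M => funMap f y)).comp
      (continuous_pi fun j => (continuous_apply i).comp (continuous_apply j))

/-- The topological closure of a substructure of a power of a finite discrete algebra. -/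
def topClosure [Finite M] [DiscreteTopology M] {I : Type*} (T : L.Substructure (I → M)) :
    L.Substructure (I → M) where
  carrier := closure (T : Set (I → M))
  fun_mem {n} f x hx := by
    -- The closure of the box `T ^ n` is the box of closures.
    have hx' : x ∈ closure (Set.univ.pi fun _ : Fin n => (T : Set (I → M))) := by
      rw [closure_pi_set]
      exact fun j _ => hx j
    exact map_mem_closure (continuous_funMap_pi f) hx' fun y hy =>
      T.fun_mem f y fun j => hy j trivial

theorem isClosed_natExt (A : Type u) [L.Structure A] :
    IsClosed (natExt L M A : Set ((A →[L] M) → M)) := by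
  rw [natExt, FirstOrder.Language.Substructure.coe_sInf]
  exact isClosed_biInter fun T hT => hT.1

theorem evalHom_mem_natExt (A : Type u) [L.Structure A] (a : A) :
    evalHom L M A a ∈ natExt L M A :=
  (natExtEval L M A a).2

/-- The dual of a finite algebra is discrete. -/
theorem discreteTopology_hom (B : Type u) [L.Structure B] [Finite B] [DiscreteTopology M] :
    DiscreteTopology (B →[L] M) :=
  DiscreteTopology.of_continuous_injective (f := fun x : B →[L] M => (x : B → M))
    continuous_induced_dom DFunLike.coe_injective

/-- The closure of the subalgebra `e_A(A)` is again a subalgebra, hence the least closed one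
containing `e_A(A)`. -/
theorem coe_natExt [Finite M] [DiscreteTopology M] (A : Type u) [L.Structure A] :
    (natExt L M A : Set ((A →[L] M) → M)) = closure (Set.range (evalHom L M A)) := by
  have hcl : (topClosure (evalHom L M A).range : Set ((A →[L] M) → M)) =
      closure (Set.range (evalHom L M A)) := by
    change closure ((evalHom L M A).range : Set ((A →[L] M) → M)) = _
    rw [FirstOrder.Language.Hom.range_coe]
  apply Set.Subset.antisymm
  · have : natExt L M A ≤ topClosure (evalHom L M A).range :=
      sInf_le ⟨hcl ▸ isClosed_closure, hcl ▸ subset_closure⟩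
    exact fun α hα => hcl ▸ this hα
  · refine closure_minimal ?_ (isClosed_natExt A)
    rintro _ ⟨a, rfl⟩
    exact evalHom_mem_natExt A a

variable [L.IsAlgebraic]

theorem InISP.of_injective {M A : Type u} [L.Structure M] [L.Structure A] [Nonempty A]
    {I : Type u} (f : A →[L] (I → M)) (hf : Function.Injective f) : InISP L M A :=
  ⟨inferInstance, I, ⟨⟨⟨f, hf⟩, fun g x => f.map_fun g x, fun r => isEmptyElim r⟩⟩⟩

theorem isBooleanTopological_of_isClosed [Finite M] [DiscreteTopology M] {I : Type*}
    (T : L.Substructure (I → M)) (hT : IsClosed (T : Set (I → M))) :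
    IsBooleanTopological L T where
  compact := isCompact_iff_compactSpace.mp hT.isCompact
  t2 := inferInstanceAs (T2Space (T : Set (I → M)))
  totallyDisconnected := inferInstanceAs (TotallyDisconnectedSpace (T : Set (I → M)))
  topological :=
    { continuous_funMap := fun f => Continuous.subtype_mk
        ((continuous_funMap_pi f).comp
          (continuous_pi fun j => continuous_subtype_val.comp (continuous_apply j))) _
      isClosed_relMap := fun r => isEmptyElim r }

/-- A homomorphism into a Boolean-topological member of a standard `IS_cP(M)` extends
continuously to the closure of the image of the evaluation map. -/
theorem IsStandard.exists_extension (hstd : IsStandard L M) {A C : Type u} [L.Structure A]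
    [L.Structure C] [TopologicalSpace C] (hC : InBt L M C) (g : A →[L] C)
    (T : L.Substructure ((A →[L] M) → M))
    (hT : (T : Set ((A →[L] M) → M)) = closure (Set.range (evalHom L M A))) :
    ∃ h : T →[L] C, Continuous h ∧
      ∀ a (ha : evalHom L M A a ∈ T), h ⟨evalHom L M A a, ha⟩ = g a := by
  -- Membership in `ISP(M)` transfers the quasi-equations of `M` to `C`, so standardness applies.
  obtain ⟨I, U, -, hU, e, he, he'⟩ :=
    (hstd C).mpr ⟨hC.2.1, hC.1, fun q hq => hq.of_inISP hC.2⟩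
  -- The coordinates of `e ∘ g` are homomorphisms `A → M`, that is, points of the index set of the
  -- big power.
  let σ : I → (A →[L] M) := fun i =>
    (piProj i).comp (U.subtype.toHom.comp (e.toHom.comp g))
  have hσ : ∀ a, piReindex (L := L) M σ (evalHom L M A a) = (e (g a) : I → M) := fun _ => rfl
  have hmem : ∀ α : T, piReindex (L := L) M σ α ∈ U := by
    rintro ⟨α, hα⟩
    have hα' : α ∈ closure (Set.range (evalHom L M A)) := hT ▸ hα
    have := map_mem_closure (continuous_piReindex (L := L) (M := M) σ) hα'
      (t := (U : Set (I → M))) (by rintro _ ⟨a, rfl⟩; rw [hσ]; exact (e (g a)).2)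
    rwa [hU.closure_eq] at this
  refine ⟨e.symm.toHom.comp
    (((piReindex M σ).comp T.subtype.toHom).codRestrict U hmem), ?_, fun a ha => ?_⟩
  · exact he'.comp (Continuous.subtype_mk
      ((continuous_piReindex σ).comp continuous_subtype_val) _)
  · exact e.symm_apply_apply (g a)

/-- The closure of the image of the evaluation map is the zero-dimensional Bohr
compactification. -/
theorem IsStandard.isZeroDimBohr [Finite M] [DiscreteTopology M] (hstd : IsStandard L M)
    {A : Type u} [L.Structure A] (hA : InISP L M A) (T : L.Substructure ((A →[L] M) → M))
    (hT : (T : Set ((A →[L] M) → M)) = closure (Set.range (evalHom L M A)))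
    (hmem : ∀ a, evalHom L M A a ∈ T) :
    IsZeroDimBohr L M A T ((evalHom L M A).codRestrict T hmem) := by
  have hne : Nonempty T := hA.1.map fun a => ⟨_, hmem a⟩
  have hinj : Function.Injective ((evalHom L M A).codRestrict T hmem) := fun a b hab =>
    hA.evalHom_injective (congrArg Subtype.val hab)
  have hdense : DenseRange ((evalHom L M A).codRestrict T hmem) := by
    rintro ⟨α, hα⟩
    rw [closure_subtype, ← Set.range_comp]
    exact (hT ▸ hα : α ∈ closure (Set.range (evalHom L M A)))
  refine ⟨⟨isBooleanTopological_of_isClosed T (hT ▸ isClosed_closure), ?_⟩, ?_, hdense, ?_⟩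
  · exact InISP.of_injective T.subtype.toHom Subtype.val_injective
  · exact ⟨⟨⟨_, hinj⟩, fun f x => FirstOrder.Language.Hom.map_fun _ f x,
      fun r => isEmptyElim r⟩, rfl⟩
  · intro C _ _ hC g
    obtain ⟨h, hcont, hh⟩ := hstd.exists_extension hC g T hT
    refine ⟨h, ⟨hcont, FirstOrder.Language.Hom.ext fun a => hh a (hmem a)⟩, ?_⟩
    -- Two continuous maps into a Hausdorff space that agree on a dense set coincide.
    rintro h' ⟨hcont', hh'⟩
    have := hC.1.t2
    apply DFunLike.coe_injective
    refine hdense.equalizer hcont' hcont (funext fun a => ?_)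
    exact (DFunLike.congr_fun hh' a).trans (hh a (hmem a)).symm

end Algebra

/-! ### Structure-preserving maps and finite approximation. -/

section Duality

variable {L : FirstOrder.Language.{v, w}} [L.IsAlgebraic] {S : Signature.{z}} {M : Type u}
  [L.Structure M] [Str S M]

/-- Precomposition with a homomorphism `A → B` preserves the structure of the duals. -/
theorem isHom_comp (hc : Compatible L S M) {A B : Type u} [L.Structure A] [L.Structure B]
    (u : A →[L] B) :
    @IsHom S (B →[L] M) (A →[L] M) (dual hc B) (dual hc A) fun y => y.comp u := by
  let := dual hc A
  let := dual hc B
  refine ⟨fun _ _ => rfl, ?_, fun _ _ hx a => hx (u a)⟩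
  rintro n h x _ ⟨hd, rfl⟩
  exact ⟨fun a => hd (u a), rfl⟩

theorem IsHom.comp {X Y Z : Type u} [Str S X] [Str S Y] [Str S Z] {β : Y → Z} {α : X → Y}
    (hβ : IsHom S β) (hα : IsHom S α) : IsHom S (β ∘ α) where
  map_op g x := (congrArg β (hα.map_op g x)).trans (hβ.map_op g _)
  map_pop h x y hy := hβ.map_pop h _ _ (hα.map_pop h x y hy)
  map_rel r x hx := hβ.map_rel r _ (hα.map_rel r x hx)

variable [Finite M] [TopologicalSpace M] [DiscreteTopology M]

/-- Each preservation condition involves only finitely many coordinates with values in a discrete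
space, so it is closed. -/
theorem isClosed_homs (hc : Compatible L S M) (X : Type u) [Str S X] :
    IsClosed (homs hc X : Set (X → M)) := by
  have hclosed : ∀ {n : ℕ} (x : Fin n → X) (y : X) (P : M → (Fin n → M) → Prop),
      IsClosed {α : X → M | P (α y) (α ∘ x)} := fun x y P =>
    (isClosed_discrete {p : M × (Fin _ → M) | P p.1 p.2}).preimage
      (f := fun α : X → M => (α y, α ∘ x))
      ((continuous_apply y).prodMk (continuous_pi fun i => continuous_apply (x i)))
  have hclosed' : ∀ {n : ℕ} (x : Fin n → X) (P : (Fin n → M) → Prop),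
      IsClosed {α : X → M | P (α ∘ x)} := fun x P =>
    (isClosed_discrete {p : Fin _ → M | P p}).preimage (f := fun α : X → M => α ∘ x)
      (continuous_pi fun i => continuous_apply (x i))
  have : (homs hc X : Set (X → M)) =
      (⋂ (n : ℕ) (g : S.Op n) (x : Fin n → X), {α | α (Str.op g x) = Str.op g (α ∘ x)}) ∩
      (⋂ (n : ℕ) (h : S.POp n) (x : Fin n → X) (y : X) (_ : y ∈ Str.pop h x),
        {α | α y ∈ Str.pop h (α ∘ x)}) ∩
      ⋂ (n : ℕ) (r : S.Rel n) (x : Fin n → X) (_ : Str.rel r x), {α | Str.rel r (α ∘ x)} := by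
    ext α
    simp only [Set.mem_inter_iff, Set.mem_iInter, Set.mem_ofPred_eq]
    exact ⟨fun h => ⟨⟨fun _ => h.map_op, fun _ => h.map_pop⟩, fun _ => h.map_rel⟩,
      fun h => ⟨h.1.1 _, h.1.2 _, h.2 _⟩⟩
  rw [this]
  refine (IsClosed.inter ?_ ?_).inter ?_
  · exact isClosed_iInter fun _ => isClosed_iInter fun g => isClosed_iInter fun x =>
      hclosed x _ fun m y => m = Str.op g y
  · exact isClosed_iInter fun _ => isClosed_iInter fun h => isClosed_iInter fun x =>
      isClosed_iInter fun y => isClosed_iInter fun _ => hclosed x y fun m z => m ∈ Str.pop h z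
  · exact isClosed_iInter fun _ => isClosed_iInter fun r => isClosed_iInter fun x =>
      isClosed_iInter fun _ => hclosed' x fun z => Str.rel r z

/-- Every structure-preserving map `A(A, M) → M` agrees on each finite set with an evaluation. -/
theorem Dualises.exists_eq_on_finset {hc : Compatible L S M} (hd : Dualises hc) {A : Type u}
    [L.Structure A] [Nonempty A] {α : (A →[L] M) → M} (hα : α ∈ doubleDual hc A)
    (F : Finset (A →[L] M)) : ∃ a : A, ∀ x ∈ F, α x = x a := by
  let u : A →[L] (F → M) := (piReindex M Subtype.val).comp (evalHom L M A)
  let B := u.range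
  let u' : A →[L] B := u.codRestrict B fun a => FirstOrder.Language.Hom.mem_range_self u a
  -- Non-emptiness of `A` is needed here, since members of `ISP(M)` are non-empty.
  have : Nonempty B := Nonempty.map u' inferInstance
  have : Finite B := Subtype.finite
  have := discreteTopology_hom (L := L) (M := M) B
  obtain ⟨φ, hφ⟩ := hd B (InISP.of_injective B.subtype.toHom Subtype.val_injective)
  let := dual hc A
  let := dual hc B
  have hα' : IsHom S α := hα
  -- Pull `α` back along the dual of `A → B`. The dual of `B` is discrete, so the result is
  -- continuous.
  have hβ : (fun y : B →[L] M => α (y.comp u')) ∈ contHoms hc (B →[L] M) :=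
    ⟨hα'.comp (isHom_comp hc u'), continuous_of_discreteTopology⟩
  obtain ⟨⟨b, a, rfl⟩, hb⟩ := φ.surjective ⟨_, hβ⟩
  refine ⟨a, fun x hx => ?_⟩
  -- Each `x ∈ F` factors through `B` as the coordinate projection at `x`.
  exact (congrFun (congrArg Subtype.val hb)
    ((piProj (⟨x, hx⟩ : F)).comp B.subtype.toHom)).symm.trans (hφ _ _)

/-- A basic open set constrains finitely many coordinates, so agreement with evaluations on finite
sets is exactly density. -/
theorem Dualises.coe_doubleDual {hc : Compatible L S M} (hd : Dualises hc) (A : Type u)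
    [L.Structure A] [Nonempty A] :
    (doubleDual hc A : Set ((A →[L] M) → M)) = closure (Set.range (evalHom L M A)) := by
  apply Set.Subset.antisymm
  · intro α hα
    rw [mem_closure_iff]
    intro V hV hαV
    obtain ⟨F, W, hW, hWV⟩ := isOpen_pi_iff.mp hV α hαV
    obtain ⟨a, ha⟩ := hd.exists_eq_on_finset hα F
    exact ⟨evalHom L M A a,
      hWV fun x hx => (ha x hx ▸ (hW x hx).2 : x a ∈ W x), a, rfl⟩
  · let := dual hc A
    refine closure_minimal ?_ (isClosed_homs hc (A →[L] M))
    rintro _ ⟨a, rfl⟩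
    exact (doubleDualEval hc A a).2

end Duality

end NatExt

theorem theorem5p4 {L : FirstOrder.Language.{v, w}} [L.IsAlgebraic]
    {M : Type u} [L.Structure M] [Finite M] [TopologicalSpace M] [DiscreteTopology M]
    (hstd : NatExt.IsStandard L M) :
    (∀ (A : Type u) [L.Structure A], NatExt.InISP L M A →
      NatExt.IsZeroDimBohr L M A (NatExt.natExt L M A) (NatExt.natExtEval L M A)) ∧
    (∀ (S : NatExt.Signature.{z}) [NatExt.Str S M] (hc : NatExt.Compatible L S M),
      NatExt.Dualises hc →
      ∀ (A : Type u) [L.Structure A], NatExt.InISP L M A →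
        NatExt.natExt L M A = NatExt.doubleDual hc A ∧
        NatExt.IsZeroDimBohr L M A (NatExt.doubleDual hc A) (NatExt.doubleDualEval hc A)) := by
  refine ⟨fun A _ hA => hstd.isZeroDimBohr hA _ (NatExt.coe_natExt A) _, ?_⟩
  intro S _ hc hd A _ hA
  have := hA.1
  exact ⟨SetLike.coe_injective ((NatExt.coe_natExt A).trans (hd.coe_doubleDual A).symm),
    hstd.isZeroDimBohr hA _ (hd.coe_doubleDual A) _⟩
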